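/- Let $\mathcal V\subset\mathbb R^2$ be the von Koch curve, i.e. the unique nonempty compact set with $\mathcal V=\bigcup_{i=1}^4 l_i(\mathcal V)$, where $$l_1(x,y)=\tfrac13(x,y),\qquad l_2(x,y)=\tfrac13\Big(\tfrac{x-\sqrt3y}{2},\tfrac{\sqrt3x+y}{2}\Big)+\big(\tfrac13,0\big),$$ $$l_3(x,y)=\tfrac13\Big(\tfrac{x+\sqrt3y}{2},\tfrac{y-\sqrt3x}{2}\Big)+\big(\tfrac12,\tfrac1{2\sqrt3}\big),\qquad l_4(x,y)=\tfrac13(x,y)+\big(\tfrac23,0\big).$$ Put $V_0=\{q_1,q_2\}$ with $q_1=(0,0)$, $q_2=(1,0)$, and $l_w=l_{w_1}\circ\cdots\circ l_{w_m}$ for a word $w\in\{1,2,3,4\}^m$. Let $(H,\mathbf r)$ be a regular harmonic structure on $\mathcal V$. That is: $H$ is a symmetric, nonpositive definite real matrix indexed by $V_0$ with nonnegative off-diagonal entries whose kernel consists of the constant functions; $\mathbf r=(r_1,\dots,r_4)$ with $0<r_i<1$; and, with $\mathcal E_0(f)=-(f,Hf)$ and $$\mathcal E_m(g)=\sum_{|w|=m}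 r_w^{-1}\,\mathcal E_0\big((g\circ l_w)|_{V_0}\big),\qquad r_w=r_{w_1}\cdots r_{w_m},$$ for every $f:V_0\to\mathbb R$ the minimum of $\mathcal E_1(g)$ over all $g$ with $g|_{V_0}=f$ is attained and equals $\mathcal E_0(f)$. (The standard structure has $r_i=\frac14$ for all $i$.) A continuous function $h:\mathcal V\to\mathbb R$ is called harmonic if for every $m\ge1$ it minimizes $\mathcal E_m$ among all functions with the same values on $V_0$. It is called piecewise harmonic of level $m$ if $h\circ l_w$ is harmonic for every word $w$ of length $m$. Let $h$ be a harmonic function, or a piecewise harmonic function of some level $m\ge1$, on $\mathcal V$, and let $G=\{(x,h(x)):x\in\mathcal V\}\subset\mathbb R^3$ be its graph. Then $$\overline{\dim}_B(G)=\limsup_{\delta\to0^+}\frac{\log N_\delta(G)}{-\log\delta}\le\frac{\log 6}{\log 3}\approx1.631,$$ where $N_\delta(G)$ is the least number of cubes of side length $\delta$ that cover $G$. In particular the box dimension of $G$, when it exists, is at most $\log6/\log3$. -/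

import Mathlib

open Filter Topology

noncomputable section

namespace VonKoch

/-- The plane `ℝ²`, in coordinates. -/
abbrev Plane : Type := Fin 2 → ℝ

/-! ### The von Koch curve -/

/-- The four contracting similarities (of ratio `1/3`) that generate the von Koch curve. -/
def kochMap : Fin 4 → Plane → Plane := ![
  fun p => ![p 0 / 3, p 1 / 3],
  fun p => ![(p 0 - √3 * p 1) / 2 / 3 + 1 / 3, (√3 * p 0 + p 1) / 2 / 3],
  fun p => ![(p 0 + √3 * p 1) / 2 / 3 + 1 / 2, (p 1 - √3 * p 0) / 2 / 3 + 1 / (2 * √3)],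
  fun p => ![p 0 / 3 + 2 / 3, p 1 / 3]]

/-- The two boundary points `q₁ = (0, 0)` and `q₂ = (1, 0)`; their set is `V₀`. -/
def q : Fin 2 → Plane := ![![0, 0], ![1, 0]]

/-- `l_w = l_{w₁} ∘ ⋯ ∘ l_{wₙ}` for a finite word `w = w₁ ⋯ wₙ`. -/
def wordMap : List (Fin 4) → Plane → Plane
  | [] => id
  | i :: w => kochMap i ∘ wordMap w

/-- `V_m`, the union over the words `w` of length `m` of the sets `l_w(V₀)`. -/
def vertices (m : ℕ) : Set Plane :=
  {p | ∃ w : List (Fin 4), w.length = m ∧ ∃ j, p = wordMap w (q j)}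

/-- The von Koch curve, as the closure of the union of all the `V_m`. By
`curve_isAttractor` and `eq_curve_of_isAttractor` below it is the attractor of the four maps,
the only nonempty compact set `K` with `K = ⋃ i, l_i(K)`. -/
def curve : Set Plane := closure (⋃ m, vertices m)

/-- `K` is an attractor of the four maps: nonempty, compact and the union of its images. -/
def IsAttractor (K : Set Plane) : Prop :=
  K.Nonempty ∧ IsCompact K ∧ K = ⋃ i, kochMap i '' K

theorem dist_kochMap_le (i : Fin 4) (x y : Plane) :
    dist (kochMap i x) (kochMap i y) ≤ 1 / 2 * dist x y := by
  have h0 : |x 0 - y 0| ≤ dist x y := by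
    rw [← Real.dist_eq]; exact dist_le_pi_dist x y 0
  have h1 : |x 1 - y 1| ≤ dist x y := by
    rw [← Real.dist_eq]; exact dist_le_pi_dist x y 1
  have s0 : 0 ≤ √(3 : ℝ) := Real.sqrt_nonneg 3
  have s2 : √(3 : ℝ) ≤ 2 := by
    rw [Real.sqrt_le_left (by norm_num)]; norm_num
  have t0 : |√3 * (x 0 - y 0)| ≤ 2 * dist x y := by
    rw [abs_mul, abs_of_nonneg s0]
    exact mul_le_mul s2 h0 (abs_nonneg _) (by norm_num)
  have t1 : |√3 * (x 1 - y 1)| ≤ 2 * dist x y := by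
    rw [abs_mul, abs_of_nonneg s0]
    exact mul_le_mul s2 h1 (abs_nonneg _) (by norm_num)
  rw [abs_le] at h0 h1 t0 t1
  refine (dist_pi_le_iff (by positivity)).2 fun j => ?_
  rw [Real.dist_eq, abs_le]
  fin_cases i <;> fin_cases j <;> simp [kochMap] <;> constructor <;> linarith

theorem continuous_kochMap (i : Fin 4) : Continuous (kochMap i) :=
  (LipschitzWith.of_dist_le_mul (K := 1 / 2) fun x y => by
    simpa using dist_kochMap_le i x y).continuous

theorem kochMap_q_zero : kochMap 0 (q 0) = q 0 := by
  ext j; fin_cases j <;> simp [kochMap, q]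

theorem kochMap_q_one : kochMap 3 (q 1) = q 1 := by
  ext j
  fin_cases j
  · change (1 : ℝ) / 3 + 2 / 3 = 1
    norm_num
  · change (0 : ℝ) / 3 = 0
    norm_num

theorem wordMap_q_mem (w : List (Fin 4)) (j : Fin 2) : wordMap w (q j) ∈ ⋃ m, vertices m :=
  Set.mem_iUnion.2 ⟨w.length, w, rfl, j, rfl⟩

theorem kochMap_zero_mem (i : Fin 4) : dist (kochMap i 0) 0 ≤ 1 := by
  have s1 : 1 ≤ √(3 : ℝ) := by
    rw [Real.one_le_sqrt]; norm_num
  refine (dist_pi_le_iff (by positivity)).2 fun j => ?_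
  have h : 1 / (2 * √3) ≤ (1 : ℝ) := by
    rw [div_le_one (by positivity)]
    linarith
  have h' : 0 ≤ (√(3 : ℝ))⁻¹ * 2⁻¹ := by positivity
  rw [Real.dist_eq, abs_le]
  fin_cases i <;> fin_cases j <;> simp [kochMap] at h ⊢ <;> (try constructor) <;> linarith

theorem dist_wordMap_q_le (w : List (Fin 4)) (j : Fin 2) : dist (wordMap w (q j)) 0 ≤ 2 := by
  induction w with
  | nil =>
    refine (dist_pi_le_iff (by positivity)).2 fun k => ?_
    fin_cases j <;> fin_cases k <;> norm_num [wordMap, q]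
  | cons i w ih =>
    have h1 := dist_triangle (kochMap i (wordMap w (q j))) (kochMap i 0) 0
    have h2 := dist_kochMap_le i (wordMap w (q j)) 0
    have h3 := kochMap_zero_mem i
    change dist (kochMap i (wordMap w (q j))) 0 ≤ 2
    linarith

theorem isCompact_curve : IsCompact curve := by
  refine (isCompact_closedBall (0 : Plane) 2).of_isClosed_subset isClosed_closure ?_
  refine closure_minimal ?_ Metric.isClosed_closedBall
  intro p hp
  obtain ⟨m, w, -, j, rfl⟩ := Set.mem_iUnion.1 hp
  exact dist_wordMap_q_le w j

/-- The von Koch curve is an attractor of the four maps. -/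
theorem curve_isAttractor : IsAttractor curve := by
  refine ⟨⟨q 0, subset_closure (wordMap_q_mem [] 0)⟩, isCompact_curve, ?_⟩
  refine Set.Subset.antisymm ?_ ?_
  · refine closure_minimal ?_
      (isCompact_iUnion fun i => isCompact_curve.image (continuous_kochMap i)).isClosed
    intro p hp
    obtain ⟨m, w, -, j, rfl⟩ := Set.mem_iUnion.1 hp
    have hq : ∀ k, q k ∈ curve := fun k => subset_closure (wordMap_q_mem [] k)
    cases w with
    | nil =>
      fin_cases j
      · exact Set.mem_iUnion.2 ⟨0, q 0, hq 0, kochMap_q_zero⟩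
      · exact Set.mem_iUnion.2 ⟨3, q 1, hq 1, kochMap_q_one⟩
    | cons i w => exact Set.mem_iUnion.2 ⟨i, _, subset_closure (wordMap_q_mem w j), rfl⟩
  · refine Set.iUnion_subset fun i => ?_
    refine (image_closure_subset_closure_image (continuous_kochMap i)).trans (closure_mono ?_)
    rintro _ ⟨p, hp, rfl⟩
    obtain ⟨m, w, -, j, rfl⟩ := Set.mem_iUnion.1 hp
    exact wordMap_q_mem (i :: w) j

theorem dist_wordMap_le (w : List (Fin 4)) (x y : Plane) :
    dist (wordMap w x) (wordMap w y) ≤ (1 / 2) ^ w.length * dist x y := by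
  induction w with
  | nil => simp [wordMap]
  | cons i w ih =>
    have h := dist_kochMap_le i (wordMap w x) (wordMap w y)
    change dist (kochMap i (wordMap w x)) (kochMap i (wordMap w y)) ≤ _
    rw [List.length_cons, pow_succ]
    linarith

/-- The four maps have no attractor other than the von Koch curve. -/
theorem eq_curve_of_isAttractor {K : Set Plane} (hK : IsAttractor K) : K = curve := by
  obtain ⟨⟨x₀, hx₀⟩, hc, hinv⟩ := hK
  have hmap : ∀ i, ∀ x ∈ K, kochMap i x ∈ K := fun i x hx => by
    rw [hinv]; exact Set.mem_iUnion.2 ⟨i, x, hx, rfl⟩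
  have hword : ∀ w : List (Fin 4), ∀ x ∈ K, wordMap w x ∈ K := by
    intro w
    induction w with
    | nil => exact fun x hx => hx
    | cons i w ih => exact fun x hx => hmap i _ (ih x hx)
  have hfix : ∀ i p, kochMap i p = p → p ∈ K := by
    intro i p hp
    have hw : ∀ n, wordMap (List.replicate n i) p = p := by
      intro n
      induction n with
      | zero => rfl
      | succ n ih =>
        change kochMap i (wordMap (List.replicate n i) p) = p
        rw [ih, hp]
    have hlim : Tendsto (fun n => wordMap (List.replicate n i) x₀) atTop (𝓝 p) := by
      rw [tendsto_iff_dist_tendsto_zero]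
      have h0 : Tendsto (fun n : ℕ => (1 / 2 : ℝ) ^ n * dist x₀ p) atTop (𝓝 0) := by
        simpa using (tendsto_pow_atTop_nhds_zero_of_lt_one (r := (1 / 2 : ℝ))
          (by norm_num) (by norm_num)).mul_const (dist x₀ p)
      refine squeeze_zero (fun _ => dist_nonneg) (fun n => ?_) h0
      have := dist_wordMap_le (List.replicate n i) x₀ p
      rwa [hw, List.length_replicate] at this
    exact hc.isClosed.mem_of_tendsto hlim (Eventually.of_forall fun n => hword _ _ hx₀)
  have hq : ∀ j, q j ∈ K := by
    intro j
    fin_cases j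
    · exact hfix 0 _ kochMap_q_zero
    · exact hfix 3 _ kochMap_q_one
  refine Set.Subset.antisymm ?_ (closure_minimal ?_ hc.isClosed)
  · have hcode : ∀ n, ∀ x ∈ K, ∃ w : List (Fin 4), w.length = n ∧ ∃ y ∈ K, wordMap w y = x := by
      intro n
      induction n with
      | zero => exact fun x hx => ⟨[], rfl, x, hx, rfl⟩
      | succ n ih =>
        intro x hx
        rw [hinv] at hx
        obtain ⟨i, y, hy, rfl⟩ := Set.mem_iUnion.1 hx
        obtain ⟨w, hw, z, hz, rfl⟩ := ih y hy
        exact ⟨i :: w, by simp [hw], z, hz, rfl⟩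
    intro x hx
    obtain ⟨C, hC⟩ := (Metric.isBounded_iff.1 hc.isBounded)
    rw [curve, Metric.mem_closure_iff]
    intro ε hε
    have h0 : Tendsto (fun n : ℕ => (1 / 2 : ℝ) ^ n * C) atTop (𝓝 0) := by
      simpa using (tendsto_pow_atTop_nhds_zero_of_lt_one (r := (1 / 2 : ℝ))
        (by norm_num) (by norm_num)).mul_const C
    obtain ⟨n, hn⟩ := (h0.eventually (gt_mem_nhds hε)).exists
    obtain ⟨w, hw, y, hy, rfl⟩ := hcode n x hx
    refine ⟨_, wordMap_q_mem w 0, ?_⟩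
    have h1 := dist_wordMap_le w y (q 0)
    rw [hw] at h1
    have h2 : (1 / 2 : ℝ) ^ n * dist y (q 0) ≤ (1 / 2) ^ n * C :=
      mul_le_mul_of_nonneg_left (hC hy (hq 0)) (by positivity)
    linarith
  · intro p hp
    obtain ⟨m, w, -, j, rfl⟩ := Set.mem_iUnion.1 hp
    exact hword w _ (hq j)

/-! ### Harmonic structures and harmonic functions

A function on the curve is represented by a function on the plane of which only the values on the
curve matter; a function on `V₀` by its values at `q 0` and `q 1`. -/

/-- Laplace matrices on `V₀`: symmetric with nonnegative off-diagonal entries, nonpositive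
definite, and with kernel the constant functions. -/
structure IsLaplaceMatrix (H : Matrix (Fin 2) (Fin 2) ℝ) : Prop where
  symm : ∀ i j, i ≠ j → H i j = H j i
  nonneg : ∀ i j, i ≠ j → 0 ≤ H i j
  nonpos : ∀ f : Fin 2 → ℝ, f ⬝ᵥ H.mulVec f ≤ 0
  ker : ∀ f : Fin 2 → ℝ, H.mulVec f = 0 ↔ ∀ i j, f i = f j

/-- The energy `𝓔₀(f) = -(f, H f)` of a function `f` on `V₀`. -/
def energyZero (H : Matrix (Fin 2) (Fin 2) ℝ) (f : Fin 2 → ℝ) : ℝ := -(f ⬝ᵥ H.mulVec f)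

/-- The energy `𝓔_m(g) = ∑_{|w| = m} r_w⁻¹ 𝓔₀((g ∘ l_w)|_{V₀})` of level `m`, where
`r_w = r_{w₁} ⋯ r_{w_m}`. It only uses the values of `g` on `V_m`. -/
def energy (H : Matrix (Fin 2) (Fin 2) ℝ) (r : Fin 4 → ℝ) (m : ℕ) (g : Plane → ℝ) : ℝ :=
  ∑ w : Fin m → Fin 4,
    (∏ k, r (w k))⁻¹ * energyZero H (fun j => g (wordMap (List.ofFn w) (q j)))

/-- `(H, r)` is a regular harmonic structure on the von Koch curve: for every `f` on `V₀`, the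
minimum of `𝓔₁(g)` over the extensions `g` of `f` is attained and equals `𝓔₀(f)`, and all `r_i`
lie in `(0, 1)`. -/
structure IsRegularHarmonicStructure (H : Matrix (Fin 2) (Fin 2) ℝ) (r : Fin 4 → ℝ) : Prop where
  laplace : IsLaplaceMatrix H
  pos : ∀ i, 0 < r i
  regular : ∀ i, r i < 1
  isLeast : ∀ f : Fin 2 → ℝ,
    IsLeast {e | ∃ g : Plane → ℝ, (∀ j, g (q j) = f j) ∧ e = energy H r 1 g} (energyZero H f)

/-- Harmonic functions on the von Koch curve: continuous functions which at every level `m ≥ 1`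
minimize the energy `𝓔_m` among the functions with the same values on `V₀`. -/
def IsHarmonic (H : Matrix (Fin 2) (Fin 2) ℝ) (r : Fin 4 → ℝ) (h : Plane → ℝ) : Prop :=
  ContinuousOn h curve ∧
    ∀ m : ℕ, 1 ≤ m → ∀ g : Plane → ℝ, (∀ j, g (q j) = h (q j)) → energy H r m h ≤ energy H r m g

/-- Piecewise harmonic functions of level `m` on the von Koch curve: continuous functions `h` for
which `h ∘ l_w` is harmonic for every word `w` of length `m`. -/
def IsPiecewiseHarmonic (H : Matrix (Fin 2) (Fin 2) ℝ) (r : Fin 4 → ℝ) (m : ℕ)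
    (h : Plane → ℝ) : Prop :=
  ContinuousOn h curve ∧
    ∀ w : List (Fin 4), w.length = m → IsHarmonic H r (h ∘ wordMap w)

/-- The graph over the von Koch curve of a function, as a subset of `ℝ³`. -/
def graphOverCurve (h : Plane → ℝ) : Set (Fin 3 → ℝ) := {p | ∃ x ∈ curve, p = ![x 0, x 1, h x]}

/-! ### Box-counting dimension -/

/-- `N_δ(F)`: the least number of (closed, axis-parallel) cubes of side length `δ` that cover `F`;
it is `∞` if no finite number of them does. -/
def coverNumber {n : ℕ} (δ : ℝ) (F : Set (Fin n → ℝ)) : ℕ∞ :=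
  ⨅ S : {S : Finset (Fin n → ℝ) // F ⊆ ⋃ a ∈ S, Set.Icc a (fun i => a i + δ)}, (S.1.card : ℕ∞)

/-- The upper box-counting dimension, `limsup_{δ → 0+} log N_δ(F) / (- log δ)`. -/
def upperBoxDim {n : ℕ} (F : Set (Fin n → ℝ)) : EReal :=
  limsup (fun δ : ℝ =>
    ENNReal.log (coverNumber δ F : ENNReal) / ((-Real.log δ : ℝ) : EReal)) (𝓝[>] 0)

end VonKoch

end

/-! On two boundary points the energy is `a * (f 1 - f 0) ^ 2`, and the four cells form a chain, so
`r` plays the role of four resistances in series. Compatibility of `𝓔₁` with `𝓔₀` then forces `∑ i,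
r i = 1` (`IsRegularHarmonicStructure.sum_eq_one`). Equality in a weighted Cauchy–Schwarz inequality
shows that a minimizer distributes its increment `D` over the cells in proportion to `r`. Hence a
harmonic function is affine in the position `pos` along the curve (`IsHarmonic.eq_pos`).

On the cell `l_w` such a function varies by at most `|D| * r_w`, and these bounds sum to `|D|` at
every level (`oscBound_of_eq_pos`); in the piecewise case the bounds for the finitely many pieces
are added. A cell of size `3⁻ⁿ`, comparable to `δ`, needs one column of cubes, of height
proportional to its oscillation. Altogether `4 ^ n + 2 * M / δ` cubes suffice (`exists_cover`),
which is `O(δ ^ (-s))` for `s = log 6 / log 3`. The count would even allow `log 4 / log 3`. -/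

namespace VonKoch

/-! ### The geometry of the cells -/

/-- The isosceles triangle on `V₀` whose apex is the midpoint of the von Koch curve. -/
def triangle : Set Plane := {p | 0 ≤ √3 * p 1 ∧ √3 * p 1 ≤ p 0 ∧ √3 * p 1 ≤ 1 - p 0}

theorem sqrt_three_mul_self : √(3 : ℝ) * √3 = 3 := Real.mul_self_sqrt (by norm_num)

/-- In the coordinates `(x, √3 * y)` the four maps have rational coefficients, which turns the case
checks on cells into linear arithmetic. -/
theorem plane_ext {p p' : Plane} (h0 : p 0 = p' 0) (h1 : √3 * p 1 = √3 * p' 1) : p = p' := by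
  ext j
  fin_cases j
  · exact h0
  · exact mul_left_cancel₀ (by positivity) h1

theorem kochMap_fst (i : Fin 4) (p : Plane) : kochMap i p 0 =
    (![p 0 / 3, (p 0 - √3 * p 1) / 6 + 1 / 3, (p 0 + √3 * p 1) / 6 + 1 / 2,
      p 0 / 3 + 2 / 3] : Fin 4 → ℝ) i := by
  fin_cases i <;> simp [kochMap] <;> ring

theorem kochMap_snd (i : Fin 4) (p : Plane) : √3 * kochMap i p 1 =
    (![√3 * p 1 / 3, (3 * p 0 + √3 * p 1) / 6, (√3 * p 1 - 3 * p 0) / 6 + 1 / 2,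
      √3 * p 1 / 3] : Fin 4 → ℝ) i := by
  have h := sqrt_three_mul_self
  fin_cases i
  · simp [kochMap]; ring
  · simp [kochMap]; linear_combination (p 0 / 6) * h
  · simp [kochMap]
    have h' : √(3 : ℝ) * (√3)⁻¹ = 1 := mul_inv_cancel₀ (by positivity)
    linear_combination (-p 0 / 6) * h + h' / 2
  · simp [kochMap]; ring

theorem kochMap_mem_triangle (i : Fin 4) {p : Plane} (hp : p ∈ triangle) :
    kochMap i p ∈ triangle := by
  obtain ⟨h1, h2, h3⟩ := hp
  have hx := kochMap_fst i p
  have hy := kochMap_snd i p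
  refine ⟨?_, ?_, ?_⟩ <;> rw [hy] <;> try rw [hx]
  all_goals fin_cases i <;> simp <;> linarith

theorem q_mem_triangle (j : Fin 2) : q j ∈ triangle := by
  fin_cases j <;> norm_num [triangle, q]

theorem wordMap_mem_triangle (w : List (Fin 4)) (j : Fin 2) : wordMap w (q j) ∈ triangle := by
  induction w with
  | nil => exact q_mem_triangle j
  | cons i w ih => exact kochMap_mem_triangle i ih

theorem kochMap_injective (i : Fin 4) : Function.Injective (kochMap i) := by
  intro p p' h
  have hx := kochMap_fst i p
  have hy := kochMap_snd i p
  rw [h, kochMap_fst i p'] at hx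
  rw [h, kochMap_snd i p'] at hy
  refine plane_ext ?_ ?_ <;> fin_cases i <;> simp at hx hy <;> first | linarith | rw [hy]

theorem kochMap_one_eq_zero : ∀ i : Fin 3, kochMap i.castSucc (q 1) = kochMap i.succ (q 0) := by
  intro i
  refine plane_ext ?_ ?_
  · rw [kochMap_fst, kochMap_fst]
    fin_cases i <;> simp [q] <;> norm_num
  · rw [kochMap_snd, kochMap_snd]
    fin_cases i <;> simp [q] <;> norm_num

/-- Two different cells of the first level meet at most in the vertex that joins them. -/
theorem kochMap_eq_kochMap {i i' : Fin 4} (hi : i < i') {p p' : Plane} (hp : p ∈ triangle)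
    (hp' : p' ∈ triangle) (h : kochMap i p = kochMap i' p') :
    i'.val = i.val + 1 ∧ p = q 1 ∧ p' = q 0 := by
  obtain ⟨h1, h2, h3⟩ := hp
  obtain ⟨h1', h2', h3'⟩ := hp'
  have hx := kochMap_fst i p
  have hy := kochMap_snd i p
  rw [h, kochMap_fst i' p'] at hx
  rw [h, kochMap_snd i' p'] at hy
  -- For cells that are not neighbours the inequalities of the two triangles are incompatible; for
  -- neighbours they leave only the common vertex.
  have key : i'.val = i.val + 1 ∧ (p 0 = 1 ∧ √3 * p 1 = 0) ∧ (p' 0 = 0 ∧ √3 * p' 1 = 0) := by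
    fin_cases i <;> fin_cases i' <;> simp at hi hx hy <;>
      first
      | (exfalso; linarith)
      | exact ⟨rfl, ⟨by linarith, by linarith⟩, by linarith, by linarith⟩
  obtain ⟨hs, ⟨e0, e1⟩, e0', e1'⟩ := key
  refine ⟨hs, plane_ext ?_ ?_, plane_ext ?_ ?_⟩
  · rw [e0]; simp [q]
  · rw [e1]; simp [q]
  · rw [e0']; simp [q]
  · rw [e1']; simp [q]

/-! ### Positions of the vertices along the curve -/

/-- The total weight of the cells of the first level that come before the cell `i`. -/
def offset (r : Fin 4 → ℝ) : Fin 4 → ℝ := ![0, r 0, r 0 + r 1, r 0 + r 1 + r 2]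

/-- The position of the vertex `l_w(q_j)` along the curve when the cell `l_w` has weight `r_w`. -/
def pos (r : Fin 4 → ℝ) : List (Fin 4) → Fin 2 → ℝ
  | [], j => (![0, 1] : Fin 2 → ℝ) j
  | i :: w, j => offset r i + r i * pos r w j

theorem offset_add (r : Fin 4 → ℝ) {i i' : Fin 4} (h : i'.val = i.val + 1) :
    offset r i + r i = offset r i' := by
  fin_cases i <;> fin_cases i' <;> simp [offset] at h ⊢

theorem offset_last (r : Fin 4 → ℝ) (hr : ∑ i, r i = 1) : offset r 3 + r 3 = 1 := by
  rw [Fin.sum_univ_four] at hr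
  simpa [offset] using hr

theorem pos_replicate_zero (r : Fin 4 → ℝ) (n : ℕ) : pos r (List.replicate n 0) 0 = 0 := by
  induction n with
  | zero => rfl
  | succ n ih => rw [List.replicate_succ, pos, ih]; simp [offset]

theorem pos_replicate_three {r : Fin 4 → ℝ} (hr : ∑ i, r i = 1) (n : ℕ) :
    pos r (List.replicate n 3) 1 = 1 := by
  induction n with
  | zero => rfl
  | succ n ih => rw [List.replicate_succ, pos, ih, mul_one, offset_last r hr]

theorem wordMap_replicate_zero (n : ℕ) : wordMap (List.replicate n 0) (q 0) = q 0 := by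
  induction n with
  | zero => rfl
  | succ n ih => rw [List.replicate_succ, wordMap, Function.comp, ih, kochMap_q_zero]

theorem wordMap_replicate_three (n : ℕ) : wordMap (List.replicate n 3) (q 1) = q 1 := by
  induction n with
  | zero => rfl
  | succ n ih => rw [List.replicate_succ, wordMap, Function.comp, ih, kochMap_q_one]

/-- The position of a vertex does not depend on the word that represents it. -/
theorem pos_eq_of_wordMap_eq {r : Fin 4 → ℝ} (hr : ∑ i, r i = 1) (n : ℕ) :
    ∀ w w' : List (Fin 4), w.length = n → w'.length = n → ∀ j j',
      wordMap w (q j) = wordMap w' (q j') → pos r w j = pos r w' j' := by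
  induction n with
  | zero =>
    intro w w' hw hw' j j' h
    rw [List.length_eq_zero_iff] at hw hw'
    subst hw hw'
    have h0 := congrFun h 0
    fin_cases j <;> fin_cases j' <;> simp [wordMap, q, pos] at h0 ⊢
  | succ n ih =>
    -- With different first letters the vertex is the junction of two neighbouring cells. The
    -- constant words `3⋯3` and `0⋯0` represent it at the right length, with positions `1` and `0`
    -- inside their cells.
    have meet : ∀ (i i' : Fin 4) (w w' : List (Fin 4)), i < i' → w.length = n → w'.length = n →
        ∀ j j', wordMap (i :: w) (q j) = wordMap (i' :: w') (q j') →
          pos r (i :: w) j = pos r (i' :: w') j' := by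
      intro i i' w w' hi hw hw' j j' h
      obtain ⟨hs, h1, h0⟩ := kochMap_eq_kochMap hi (wordMap_mem_triangle w j)
        (wordMap_mem_triangle w' j') h
      have e1 := ih w (List.replicate n 3) hw List.length_replicate j 1
        (h1.trans (wordMap_replicate_three n).symm)
      have e0 := ih w' (List.replicate n 0) hw' List.length_replicate j' 0
        (h0.trans (wordMap_replicate_zero n).symm)
      rw [pos_replicate_three hr] at e1
      rw [pos_replicate_zero] at e0
      rw [pos, pos, e1, e0, mul_one, mul_zero, add_zero, offset_add r hs]
    intro w w' hw hw' j j' h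
    match w, w', hw, hw' with
    | i :: w, i' :: w', hw, hw' =>
      rw [List.length_cons, Nat.add_right_cancel_iff] at hw hw'
      rcases lt_trichotomy i i' with hi | hi | hi
      · exact meet i i' w w' hi hw hw' j j' h
      · subst hi
        rw [pos, pos, ih w w' hw hw' j j' (kochMap_injective i h)]
      · exact (meet i' i w' w hi hw' hw j' j h.symm).symm

/-- Provides competitors for the minimum problems. These range over functions of points, not of
words, so independence of the word is essential; the value off `V_m` plays no role in `𝓔_m`. -/
theorem exists_eq_pos {r : Fin 4 → ℝ} (hr : ∑ i, r i = 1) (m : ℕ) (c D : ℝ) :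
    ∃ g : Plane → ℝ, ∀ w : List (Fin 4), w.length = m → ∀ j,
      g (wordMap w (q j)) = c + D * pos r w j := by
  classical
  refine ⟨fun x => if hx : ∃ w : List (Fin 4), w.length = m ∧ ∃ j, x = wordMap w (q j) then
    c + D * pos r hx.choose hx.choose_spec.2.choose else 0, fun w hw j => ?_⟩
  have hx : ∃ w' : List (Fin 4), w'.length = m ∧ ∃ j', wordMap w (q j) = wordMap w' (q j') :=
    ⟨w, hw, j, rfl⟩
  simp only [dif_pos hx]
  rw [pos_eq_of_wordMap_eq hr m w hx.choose hw hx.choose_spec.1 j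
    hx.choose_spec.2.choose hx.choose_spec.2.choose_spec]

theorem pos_mem_Icc {r : Fin 4 → ℝ} (hr : ∑ i, r i = 1) (h0 : ∀ i, 0 ≤ r i)
    (w : List (Fin 4)) (j : Fin 2) : pos r w j ∈ Set.Icc 0 1 := by
  induction w with
  | nil => fin_cases j <;> simp [pos]
  | cons i w ih =>
    have ho : 0 ≤ offset r i ∧ offset r i + r i ≤ 1 := by
      rw [Fin.sum_univ_four] at hr
      have := h0 0
      have := h0 1
      have := h0 2
      have := h0 3
      fin_cases i <;> simp [offset] <;> first | linarith | constructor <;> linarith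
    rw [pos]
    have h1 : r i * pos r w j ≤ r i := mul_le_of_le_one_right (h0 i) ih.2
    exact ⟨add_nonneg ho.1 (mul_nonneg (h0 i) ih.1), by linarith⟩

/-! ### Energies -/

/-- Constants in the kernel make the row sums zero, so symmetry leaves the single parameter `H 0 1`.
It cannot vanish, since the kernel contains nothing but constants. -/
theorem IsLaplaceMatrix.exists_conductance {H : Matrix (Fin 2) (Fin 2) ℝ}
    (hH : IsLaplaceMatrix H) :
    ∃ a : ℝ, 0 < a ∧ ∀ f : Fin 2 → ℝ, energyZero H f = a * (f 1 - f 0) ^ 2 := by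
  have hs := hH.symm 0 1 (by decide)
  have hn := hH.nonneg 0 1 (by decide)
  have hk := (hH.ker 1).2 fun _ _ => rfl
  have k0 := congrFun hk 0
  have k1 := congrFun hk 1
  simp only [Matrix.mulVec, dotProduct, Fin.sum_univ_two, Pi.one_apply, Pi.zero_apply,
    mul_one] at k0 k1
  have e00 : H 0 0 = -H 0 1 := by linarith
  have e11 : H 1 1 = -H 0 1 := by linarith
  refine ⟨H 0 1, lt_of_le_of_ne hn fun h0 => ?_, fun f => ?_⟩
  · have := (hH.ker ![0, 1]).1 (by
      ext j
      fin_cases j <;> simp [Matrix.mulVec, dotProduct, Fin.sum_univ_two] <;> linarith) 0 1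
    simp at this
  · simp only [energyZero, Matrix.mulVec, dotProduct, Fin.sum_univ_two]
    rw [e00, e11, ← hs]
    ring

theorem energy_zero (H : Matrix (Fin 2) (Fin 2) ℝ) (r : Fin 4 → ℝ) (g : Plane → ℝ) :
    energy H r 0 g = energyZero H fun j => g (q j) := by
  simp [energy, wordMap]

/-- Self-similarity of the energy: splitting off the first letter reduces each induction on the
level to the restrictions of `g` to the four cells. -/
theorem energy_succ (H : Matrix (Fin 2) (Fin 2) ℝ) (r : Fin 4 → ℝ) (m : ℕ) (g : Plane → ℝ) :
    energy H r (m + 1) g = ∑ i, (r i)⁻¹ * energy H r m (g ∘ kochMap i) := by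
  simp only [energy]
  rw [← (Fin.consEquiv fun _ : Fin (m + 1) => Fin 4).sum_comp, Fintype.sum_prod_type]
  refine Finset.sum_congr rfl fun i _ => ?_
  rw [Finset.mul_sum]
  refine Finset.sum_congr rfl fun w _ => ?_
  simp [Fin.consEquiv, Fin.prod_univ_succ, List.ofFn_succ, wordMap, mul_assoc, mul_comm]

/-- Consecutive cells share a vertex, so the sum telescopes. -/
theorem sum_increments (g : Plane → ℝ) :
    ∑ i, (g (kochMap i (q 1)) - g (kochMap i (q 0))) = g (q 1) - g (q 0) := by
  have h0 := kochMap_one_eq_zero 0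
  have h1 := kochMap_one_eq_zero 1
  have h2 := kochMap_one_eq_zero 2
  simp only [Fin.castSucc_zero, Fin.succ_zero_eq_one, Fin.castSucc_one, Fin.succ_one_eq_two,
    show (2 : Fin 3).castSucc = 2 from rfl, show (2 : Fin 3).succ = 3 from rfl] at h0 h1 h2
  rw [Fin.sum_univ_four, h0, h1, h2, kochMap_q_zero, kochMap_q_one]
  ring

theorem apply_kochMap_q_zero {r : Fin 4 → ℝ} {g : Plane → ℝ} {D : ℝ}
    (h : ∀ i, g (kochMap i (q 1)) - g (kochMap i (q 0)) = r i * D) (i : Fin 4) :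
    g (kochMap i (q 0)) = g (q 0) + D * offset r i := by
  have h0 := kochMap_one_eq_zero 0
  have h1 := kochMap_one_eq_zero 1
  have h2 := kochMap_one_eq_zero 2
  simp only [Fin.castSucc_zero, Fin.succ_zero_eq_one, Fin.castSucc_one, Fin.succ_one_eq_two,
    show (2 : Fin 3).castSucc = 2 from rfl, show (2 : Fin 3).succ = 3 from rfl] at h0 h1 h2
  have d0 := h 0
  have d1 := h 1
  have d2 := h 2
  rw [h0, kochMap_q_zero] at d0
  rw [h1] at d1
  rw [h2] at d2
  fin_cases i <;> simp [offset]
  · rw [kochMap_q_zero]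
  all_goals linarith

/-- This is the variance of `d i / r i` under the weights `r i`. Its sign gives the lower bound for
the energy, its vanishing the shape of the minimizers. -/
theorem sum_sq_div_sub {r d : Fin 4 → ℝ} (hpos : ∀ i, 0 < r i) (hr : ∑ i, r i = 1) :
    ∑ i, (r i)⁻¹ * (d i - r i * ∑ k, d k) ^ 2 = ∑ i, (r i)⁻¹ * d i ^ 2 - (∑ k, d k) ^ 2 := by
  set D := ∑ k, d k with hD
  have h : ∀ i, (r i)⁻¹ * (d i - r i * D) ^ 2
      = (r i)⁻¹ * d i ^ 2 - 2 * D * d i + D ^ 2 * r i := fun i => by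
    have := (hpos i).ne'
    field_simp
    ring
  rw [Finset.sum_congr rfl fun i _ => h i, Finset.sum_add_distrib, Finset.sum_sub_distrib,
    ← Finset.mul_sum, ← Finset.mul_sum, ← hD, hr]
  ring

section Energy

variable {H : Matrix (Fin 2) (Fin 2) ℝ} {r : Fin 4 → ℝ} {a : ℝ}

theorem le_energy (ha : 0 < a) (hH : ∀ f : Fin 2 → ℝ, energyZero H f = a * (f 1 - f 0) ^ 2)
    (hpos : ∀ i, 0 < r i) (hr : ∑ i, r i = 1) (m : ℕ) (g : Plane → ℝ) :
    a * (g (q 1) - g (q 0)) ^ 2 ≤ energy H r m g := by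
  induction m generalizing g with
  | zero => rw [energy_zero, hH]
  | succ m ih =>
    have hsub := sum_sq_div_sub (d := fun i => g (kochMap i (q 1)) - g (kochMap i (q 0))) hpos hr
    rw [sum_increments] at hsub
    have h0 : 0 ≤ ∑ i, (r i)⁻¹ * (g (kochMap i (q 1)) - g (kochMap i (q 0))
        - r i * (g (q 1) - g (q 0))) ^ 2 :=
      Finset.sum_nonneg fun i _ => mul_nonneg (inv_nonneg.2 (hpos i).le) (sq_nonneg _)
    calc a * (g (q 1) - g (q 0)) ^ 2
        ≤ a * ∑ i, (r i)⁻¹ * (g (kochMap i (q 1)) - g (kochMap i (q 0))) ^ 2 :=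
          mul_le_mul_of_nonneg_left (by linarith) ha.le
      _ = ∑ i, (r i)⁻¹ * (a * (g (kochMap i (q 1)) - g (kochMap i (q 0))) ^ 2) := by
          rw [Finset.mul_sum]
          exact Finset.sum_congr rfl fun i _ => by ring
      _ ≤ energy H r (m + 1) g := by
          rw [energy_succ]
          exact Finset.sum_le_sum fun i _ =>
            mul_le_mul_of_nonneg_left (ih (g ∘ kochMap i)) (inv_nonneg.2 (hpos i).le)

/-- The energy minimizers are affine in the position. -/
theorem eq_pos_of_energy_le (ha : 0 < a)
    (hH : ∀ f : Fin 2 → ℝ, energyZero H f = a * (f 1 - f 0) ^ 2)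
    (hpos : ∀ i, 0 < r i) (hr : ∑ i, r i = 1) (m : ℕ) (g : Plane → ℝ)
    (hg : energy H r m g ≤ a * (g (q 1) - g (q 0)) ^ 2) (w : List (Fin 4)) (hw : w.length = m)
    (j : Fin 2) : g (wordMap w (q j)) = g (q 0) + (g (q 1) - g (q 0)) * pos r w j := by
  induction m generalizing g w with
  | zero =>
    rw [List.length_eq_zero_iff] at hw
    subst hw
    fin_cases j <;> simp [wordMap, pos]
  | succ m ih =>
    have hinv : ∀ i, 0 < (r i)⁻¹ := fun i => inv_pos.2 (hpos i)
    have hsub := sum_sq_div_sub (d := fun i => g (kochMap i (q 1)) - g (kochMap i (q 0))) hpos hr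
    rw [sum_increments] at hsub
    set D := g (q 1) - g (q 0) with hD
    -- The excess of the energy over its lower bound splits into the excess inside each cell and the
    -- variance of the increments. All terms are nonnegative and the total is at most zero, so each
    -- vanishes.
    have hnn : ∀ i ∈ Finset.univ, 0 ≤
        (r i)⁻¹ * (energy H r m (g ∘ kochMap i)
          - a * (g (kochMap i (q 1)) - g (kochMap i (q 0))) ^ 2)
        + a * ((r i)⁻¹ * (g (kochMap i (q 1)) - g (kochMap i (q 0)) - r i * D) ^ 2) :=
      fun i _ => add_nonneg (mul_nonneg (hinv i).le
          (sub_nonneg.2 (le_energy ha hH hpos hr m (g ∘ kochMap i))))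
        (mul_nonneg ha.le (mul_nonneg (hinv i).le (sq_nonneg _)))
    have hsum : ∑ i, ((r i)⁻¹ * (energy H r m (g ∘ kochMap i)
          - a * (g (kochMap i (q 1)) - g (kochMap i (q 0))) ^ 2)
        + a * ((r i)⁻¹ * (g (kochMap i (q 1)) - g (kochMap i (q 0)) - r i * D) ^ 2)) = 0 := by
      refine le_antisymm ?_ (Finset.sum_nonneg hnn)
      have e1 : ∑ i, (r i)⁻¹ * (a * (g (kochMap i (q 1)) - g (kochMap i (q 0))) ^ 2)
          = a * ∑ i, (r i)⁻¹ * (g (kochMap i (q 1)) - g (kochMap i (q 0))) ^ 2 := by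
        rw [Finset.mul_sum]
        exact Finset.sum_congr rfl fun i _ => by ring
      rw [energy_succ] at hg
      simp only [mul_sub (r _)⁻¹ (energy _ _ _ _)]
      rw [Finset.sum_add_distrib, ← Finset.mul_sum, hsub, Finset.sum_sub_distrib, e1]
      linarith
    have hz := (Finset.sum_eq_zero_iff_of_nonneg hnn).1 hsum
    have hcell : ∀ i, energy H r m (g ∘ kochMap i)
          ≤ a * ((g ∘ kochMap i) (q 1) - (g ∘ kochMap i) (q 0)) ^ 2 ∧
        g (kochMap i (q 1)) - g (kochMap i (q 0)) = r i * D := by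
      intro i
      have h1 := mul_nonneg (hinv i).le
        (sub_nonneg.2 (le_energy ha hH hpos hr m (g ∘ kochMap i)))
      have h2 := mul_nonneg ha.le (mul_nonneg (hinv i).le
        (sq_nonneg (g (kochMap i (q 1)) - g (kochMap i (q 0)) - r i * D)))
      obtain ⟨z1, z2⟩ := (add_eq_zero_iff_of_nonneg h1 h2).1 (hz i (Finset.mem_univ i))
      refine ⟨(sub_eq_zero.1 ((mul_eq_zero.1 z1).resolve_left (hinv i).ne')).le, ?_⟩
      have z3 := (mul_eq_zero.1 ((mul_eq_zero.1 z2).resolve_left ha.ne')).resolve_left (hinv i).ne'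
      exact sub_eq_zero.1 (pow_eq_zero_iff two_ne_zero |>.1 z3)
    match w, hw with
    | i :: w, hw =>
      have hi := ih (g ∘ kochMap i) (hcell i).1 w (by simpa using hw)
      simp only [Function.comp] at hi
      change g (kochMap i (wordMap w (q j))) = _
      rw [hi, (hcell i).2, apply_kochMap_q_zero (fun i => (hcell i).2) i, pos]
      ring

/-- The weights `r'` of the position are kept apart from `r`: before `∑ i, r i = 1` is known,
competitors must use normalized weights, and `R` records the change of energy per level. -/
theorem energy_eq_of_eq_pos {r' : Fin 4 → ℝ} {R : ℝ}
    (hH : ∀ f : Fin 2 → ℝ, energyZero H f = a * (f 1 - f 0) ^ 2)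
    (hR : ∑ i, (r i)⁻¹ * r' i ^ 2 = R) (m : ℕ) (c D : ℝ) (g : Plane → ℝ)
    (hg : ∀ w : List (Fin 4), w.length = m → ∀ j, g (wordMap w (q j)) = c + D * pos r' w j) :
    energy H r m g = R ^ m * (a * D ^ 2) := by
  induction m generalizing g c D with
  | zero =>
    have h0 := hg [] rfl 0
    have h1 := hg [] rfl 1
    simp only [wordMap, id, pos, Matrix.cons_val_zero, Matrix.cons_val_one] at h0 h1
    rw [energy_zero, hH, h0, h1]
    ring
  | succ m ih =>
    have hi : ∀ i, energy H r m (g ∘ kochMap i) = R ^ m * (a * (D * r' i) ^ 2) := fun i =>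
      ih (c + D * offset r' i) (D * r' i) (g ∘ kochMap i) fun w hw j => by
        have h := hg (i :: w) (by simp [hw]) j
        rw [pos] at h
        change g (kochMap i (wordMap w (q j))) = _ at h
        rw [Function.comp, h]
        ring
    have e : R ^ (m + 1) * (a * D ^ 2) = ∑ i, R ^ m * ((r i)⁻¹ * r' i ^ 2 * (a * D ^ 2)) := by
      rw [← Finset.mul_sum, ← Finset.sum_mul, hR]
      ring
    rw [energy_succ, e]
    exact Finset.sum_congr rfl fun i _ => by rw [hi]; ring

/-- Series law: for boundary values `0, 1` the minimum of `𝓔₁` is `a / R`, and it has to equal `a`.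
The affine competitor with weights `r i / R` yields `R ≤ 1`; Cauchy–Schwarz applied to a minimizer
yields `1 ≤ R`. -/
theorem IsRegularHarmonicStructure.sum_eq_one (hHr : IsRegularHarmonicStructure H r) :
    ∑ i, r i = 1 := by
  obtain ⟨a, ha, hH⟩ := hHr.laplace.exists_conductance
  have hpos := hHr.pos
  set R := ∑ i, r i with hR
  have hR0 : 0 < R := Finset.sum_pos (fun i _ => hpos i) Finset.univ_nonempty
  have hr' : ∑ i, r i / R = 1 := by rw [← Finset.sum_div, ← hR, div_self hR0.ne']
  obtain ⟨⟨g, hg, hge⟩, hmin⟩ := hHr.isLeast ![0, 1]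
  have g0 : g (q 0) = 0 := hg 0
  have g1 : g (q 1) = 1 := hg 1
  refine le_antisymm ?_ ?_
  · obtain ⟨g', hg'⟩ := exists_eq_pos hr' 1 0 1
    have hb : ∀ j, g' (q j) = (![0, 1] : Fin 2 → ℝ) j := by
      intro j
      fin_cases j
      · have h := hg' [0] rfl 0
        rw [show [(0 : Fin 4)] = List.replicate 1 0 from rfl, pos_replicate_zero,
          wordMap_replicate_zero] at h
        simpa using h
      · have h := hg' [3] rfl 1
        rw [show [(3 : Fin 4)] = List.replicate 1 3 from rfl, pos_replicate_three hr',
          wordMap_replicate_three] at h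
        simpa using h
    have hle := hmin ⟨g', hb, rfl⟩
    have hsum : ∑ i, (r i)⁻¹ * (r i / R) ^ 2 = R⁻¹ := by
      have : ∀ i, (r i)⁻¹ * (r i / R) ^ 2 = r i * (R⁻¹) ^ 2 := fun i => by
        have := (hpos i).ne'
        field_simp
      rw [Finset.sum_congr rfl fun i _ => this i, ← Finset.sum_mul, ← hR]
      field_simp
    rw [energy_eq_of_eq_pos hH hsum 1 0 1 g' hg', hH] at hle
    simp only [Matrix.cons_val_zero, Matrix.cons_val_one, sub_zero, one_pow, mul_one,
      pow_one] at hle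
    have h1 : 1 ≤ R⁻¹ := by
      by_contra! hlt
      have := mul_lt_mul_of_pos_right hlt ha
      linarith
    exact (one_le_inv₀ hR0).1 h1
  · rw [energy_succ, hH] at hge
    simp only [energy_zero, hH, Function.comp] at hge
    have hsum : ∑ i, (r i)⁻¹ * (g (kochMap i (q 1)) - g (kochMap i (q 0))) ^ 2 = 1 := by
      have : ∑ i, (r i)⁻¹ * (a * (g (kochMap i (q 1)) - g (kochMap i (q 0))) ^ 2)
          = a * ∑ i, (r i)⁻¹ * (g (kochMap i (q 1)) - g (kochMap i (q 0))) ^ 2 := by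
        rw [Finset.mul_sum]
        exact Finset.sum_congr rfl fun i _ => by ring
      rw [this] at hge
      have h := mul_left_cancel₀ ha.ne' hge
      simpa using h.symm
    have hd := sum_increments g
    rw [g0, g1, sub_zero] at hd
    have hcs := Finset.sum_sq_le_sum_mul_sum_of_sq_le_mul Finset.univ
      (r := fun i => g (kochMap i (q 1)) - g (kochMap i (q 0)))
      (f := fun i => (r i)⁻¹ * (g (kochMap i (q 1)) - g (kochMap i (q 0))) ^ 2) (g := r)
      (fun i _ => mul_nonneg (inv_nonneg.2 (hpos i).le) (sq_nonneg _)) (fun i _ => (hpos i).le)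
      (fun i _ => by have := (hpos i).ne'; field_simp; rfl)
    rw [hd, hsum, one_pow, one_mul] at hcs
    exact hcs

/-- A harmonic function is affine in the position of the vertices. -/
theorem IsHarmonic.eq_pos (hHr : IsRegularHarmonicStructure H r) {h : Plane → ℝ}
    (hh : IsHarmonic H r h) (w : List (Fin 4)) (j : Fin 2) :
    h (wordMap w (q j)) = h (q 0) + (h (q 1) - h (q 0)) * pos r w j := by
  obtain ⟨a, ha, hH⟩ := hHr.laplace.exists_conductance
  have hr := hHr.sum_eq_one
  have hpos := hHr.pos
  refine eq_pos_of_energy_le ha hH hpos hr w.length h ?_ w rfl j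
  -- Harmonicity says nothing at level `0`, where the energy bound is an identity. At higher levels
  -- the affine competitor attains the lower bound, and `h` has no more energy than it.
  rcases Nat.eq_zero_or_pos w.length with h0 | h0
  · rw [h0, energy_zero, hH]
  obtain ⟨g, hg⟩ := exists_eq_pos hr w.length (h (q 0)) (h (q 1) - h (q 0))
  have hb : ∀ j, g (q j) = h (q j) := by
    intro j
    fin_cases j
    · have e := hg (List.replicate w.length 0) List.length_replicate 0
      rw [wordMap_replicate_zero, pos_replicate_zero] at e
      simpa using e
    · have e := hg (List.replicate w.length 3) List.length_replicate 1
      rw [wordMap_replicate_three, pos_replicate_three hr] at e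
      simpa using e
  have hsum : ∑ i, (r i)⁻¹ * r i ^ 2 = 1 := by
    rw [← hr]
    exact Finset.sum_congr rfl fun i _ => by
      have := (hpos i).ne'
      field_simp
  refine (hh.2 w.length h0 g hb).trans_eq ?_
  rw [energy_eq_of_eq_pos hH hsum _ _ _ g hg, one_pow, one_mul]

end Energy

/-! ### Oscillations -/

/-- `M` bounds the sum of bounds for the oscillations of `h` on the cells of level `n`. -/
def OscBound : ℕ → (Plane → ℝ) → ℝ → Prop
  | 0, h, M => ∀ x ∈ curve, |h x - h (q 0)| ≤ M
  | n + 1, h, M => ∃ B : Fin 4 → ℝ, ∑ i, B i = M ∧ ∀ i, OscBound n (h ∘ kochMap i) (B i)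

theorem mapsTo_kochMap_curve (i : Fin 4) : Set.MapsTo (kochMap i) curve curve := fun x hx => by
  rw [curve_isAttractor.2.2]
  exact Set.mem_iUnion.2 ⟨i, x, hx, rfl⟩

theorem q_mem_curve (j : Fin 2) : q j ∈ curve := subset_closure (wordMap_q_mem [] j)

/-- Positions lie in `[0, 1]` and the vertices are dense, so continuity bounds the variation on a
cell by its increment. Passing to subcells multiplies `D` by `r i`; since these sum to `1`, the
total does not grow with `n`. -/
theorem oscBound_of_eq_pos {r : Fin 4 → ℝ} (hr : ∑ i, r i = 1) (hpos : ∀ i, 0 < r i) (n : ℕ)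
    (h : Plane → ℝ) (hc : ContinuousOn h curve) (c D : ℝ)
    (hh : ∀ w j, h (wordMap w (q j)) = c + D * pos r w j) : OscBound n h |D| := by
  induction n generalizing h c D with
  | zero =>
    intro x hx
    have hvert : (⋃ m, vertices m) ⊆ h ⁻¹' Metric.closedBall (h (q 0)) |D| := by
      intro y hy
      obtain ⟨m, w, -, j, rfl⟩ := Set.mem_iUnion.1 hy
      have h0 := hh [] 0
      simp only [wordMap, id, pos, Matrix.cons_val_zero, mul_zero, add_zero] at h0
      obtain ⟨p0, p1⟩ := pos_mem_Icc hr (fun i => (hpos i).le) w j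
      rw [Set.mem_preimage, Metric.mem_closedBall, Real.dist_eq, hh, h0, add_sub_cancel_left, abs_mul,
        abs_of_nonneg p0]
      exact mul_le_of_le_one_right (abs_nonneg D) p1
    have := closure_minimal (Set.image_subset_iff.2 hvert) Metric.isClosed_closedBall
      (hc.image_closure ⟨x, hx, rfl⟩)
    rwa [Metric.mem_closedBall, Real.dist_eq] at this
  | succ n ih =>
    refine ⟨fun i => |D * r i|, ?_, fun i => ?_⟩
    · simp only [abs_mul, abs_of_pos (hpos _)]
      rw [← Finset.mul_sum, hr, mul_one]
    · refine ih _ (hc.comp (continuous_kochMap i).continuousOn (mapsTo_kochMap_curve i))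
        (c + D * offset r i) _ fun w j => ?_
      have e := hh (i :: w) j
      rw [pos] at e
      change h (kochMap i (wordMap w (q j))) = _ at e
      rw [Function.comp, e]
      ring

theorem exists_oscBound_of_wordMap (m : ℕ) (h : Plane → ℝ)
    (hh : ∀ w : List (Fin 4), w.length = m → ∃ M, 0 ≤ M ∧ ∀ n, OscBound n (h ∘ wordMap w) M) :
    ∃ M, 0 ≤ M ∧ ∀ n, OscBound (n + m) h M := by
  induction m generalizing h with
  | zero => exact hh [] rfl
  | succ m ih =>
    have hi : ∀ i, ∃ M, 0 ≤ M ∧ ∀ n, OscBound (n + m) (h ∘ kochMap i) M := fun i =>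
      ih _ fun w hw => hh (i :: w) (by simp [hw])
    choose B hB0 hB using hi
    exact ⟨∑ i, B i, Finset.sum_nonneg fun i _ => hB0 i, fun n => ⟨B, rfl, fun i => hB i n⟩⟩

/-! ### Coverings -/

/-- The square of the Euclidean distance. -/
def sqDist (x y : Plane) : ℝ := (x 0 - y 0) ^ 2 + (x 1 - y 1) ^ 2

/-- The exact ratio `1/3` needs the Euclidean distance, because rotations distort the sup distance
of `Plane`. The cruder ratio `1/2` of `dist_kochMap_le` would only give dimension `2`. -/
theorem sqDist_kochMap (i : Fin 4) (x y : Plane) :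
    sqDist (kochMap i x) (kochMap i y) = (1 / 3) ^ 2 * sqDist x y := by
  have h := sqrt_three_mul_self
  have h3 : ∀ u v : Plane, 3 * sqDist u v
      = 3 * (u 0 - v 0) ^ 2 + (√3 * u 1 - √3 * v 1) ^ 2 := fun u v => by
    rw [sqDist]
    linear_combination (-(u 1 - v 1) ^ 2) * h
  refine mul_left_cancel₀ (three_ne_zero (α := ℝ)) ?_
  rw [mul_left_comm, h3, h3, kochMap_fst, kochMap_fst, kochMap_snd, kochMap_snd]
  fin_cases i <;> simp <;> ring

theorem sqDist_le_of_mem_curve {x : Plane} (hx : x ∈ curve) : sqDist x (q 0) ≤ 1 := by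
  have hclosed : IsClosed {x : Plane | sqDist x (q 0) ≤ 1} :=
    isClosed_le (by unfold sqDist; fun_prop) continuous_const
  refine closure_minimal ?_ hclosed hx
  intro y hy
  obtain ⟨m, w, -, j, rfl⟩ := Set.mem_iUnion.1 hy
  obtain ⟨h1, h2, h3⟩ := wordMap_mem_triangle w j
  set p := wordMap w (q j)
  change (p 0 - 0) ^ 2 + (p 1 - 0) ^ 2 ≤ 1
  have h := sqrt_three_mul_self
  have e : (√3 * p 1) ^ 2 = 3 * p 1 ^ 2 := by linear_combination (p 1 ^ 2) * h
  nlinarith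

/-- A cover by cubes of a graph over the curve, placed in space by a map which contracts by `K`. -/
theorem exists_cover {δ : ℝ} (hδ : 0 < δ) (n : ℕ) (K : ℝ) (hK0 : 0 ≤ K)
    (hK : 2 * (K * (1 / 3) ^ n) ≤ δ)
    (A : Plane → Plane) (hA : ∀ x y, sqDist (A x) (A y) ≤ K ^ 2 * sqDist x y)
    (h : Plane → ℝ) (M : ℝ) (hM : OscBound n h M) :
    ∃ S : Finset (Fin 3 → ℝ), (S.card : ℝ) ≤ 4 ^ n + 2 * M / δ ∧
      ∀ x ∈ curve, ∃ a ∈ S, ![A x 0, A x 1, h x] ∈ Set.Icc a (fun i => a i + δ) := by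
  classical
  induction n generalizing K A h M with
  | zero =>
    have hM0 : 0 ≤ M := (abs_nonneg _).trans (hM (q 0) (q_mem_curve 0))
    -- One column of cubes: the base, of side `δ ≥ 2 * K`, contains the footprint of the cell, and
    -- the stack covers the height `2 * M`. The extra cube of each column accounts for the term `4 ^
    -- n`.
    refine ⟨(Finset.range (⌊2 * M / δ⌋₊ + 1)).image fun k : ℕ =>
      ![A (q 0) 0 - K, A (q 0) 1 - K, h (q 0) - M + k * δ], ?_, fun x hx => ?_⟩
    · have h1 := Finset.card_image_le (s := Finset.range (⌊2 * M / δ⌋₊ + 1))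
        (f := fun k : ℕ => ![A (q 0) 0 - K, A (q 0) 1 - K, h (q 0) - M + k * δ])
      rw [Finset.card_range] at h1
      have h2 := Nat.floor_le (show 0 ≤ 2 * M / δ by positivity)
      have h3 : ((Finset.image (fun k : ℕ => ![A (q 0) 0 - K, A (q 0) 1 - K,
        h (q 0) - M + k * δ]) (Finset.range (⌊2 * M / δ⌋₊ + 1))).card : ℝ)
          ≤ (⌊2 * M / δ⌋₊ : ℝ) + 1 := by exact_mod_cast h1
      rw [pow_zero]
      linarith
    · have hd : sqDist (A x) (A (q 0)) ≤ K ^ 2 := (hA x (q 0)).trans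
        (mul_le_of_le_one_right (sq_nonneg K) (sqDist_le_of_mem_curve hx))
      rw [sqDist] at hd
      have hx0 := abs_le.1 (abs_le_of_sq_le_sq (a := A x 0 - A (q 0) 0)
        (by nlinarith [sq_nonneg (A x 1 - A (q 0) 1)]) hK0)
      have hx1 := abs_le.1 (abs_le_of_sq_le_sq (a := A x 1 - A (q 0) 1)
        (by nlinarith [sq_nonneg (A x 0 - A (q 0) 0)]) hK0)
      have hz := abs_le.1 (hM x hx)
      rw [pow_zero, mul_one] at hK
      set t := (h x - (h (q 0) - M)) / δ with ht
      have ht0 : 0 ≤ t := div_nonneg (by linarith [hz.1]) hδ.le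
      have htδ : t * δ = h x - (h (q 0) - M) := div_mul_cancel₀ _ hδ.ne'
      have htM : t ≤ 2 * M / δ := div_le_div_of_nonneg_right (by linarith [hz.2]) hδ.le
      have f1 := mul_le_mul_of_nonneg_right (Nat.floor_le ht0) hδ.le
      have f2 := mul_le_mul_of_nonneg_right (Nat.lt_floor_add_one t).le hδ.le
      refine ⟨_, Finset.mem_image_of_mem _ (Finset.mem_range.2
        (Nat.lt_succ_of_le (Nat.floor_le_floor htM))), ?_, ?_⟩
      · intro j
        fin_cases j <;> simp <;> linarith [hx0.1, hx1.1]
      · intro j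
        fin_cases j <;> simp <;> linarith [hx0.2, hx1.2]
  | succ n ih =>
    obtain ⟨B, hB, hi⟩ := hM
    -- The contraction of the subcell is absorbed into the placement `A`, so the footprint shrinks
    -- by `3` while `δ` stays fixed.
    have hcov := fun i => ih (K / 3) (by positivity)
      (by rw [pow_succ] at hK; linarith) (A ∘ kochMap i)
      (fun x y => (hA _ _).trans_eq (by rw [sqDist_kochMap]; ring)) (h ∘ kochMap i) (B i) (hi i)
    choose S hS hmem using hcov
    refine ⟨Finset.univ.biUnion S, ?_, fun x hx => ?_⟩
    · calc ((Finset.univ.biUnion S).card : ℝ) ≤ ∑ i, ((S i).card : ℝ) := by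
            exact_mod_cast Finset.card_biUnion_le
        _ ≤ ∑ i, (4 ^ n + 2 * B i / δ) := Finset.sum_le_sum fun i _ => hS i
        _ = 4 ^ (n + 1) + 2 * M / δ := by
            rw [Finset.sum_add_distrib, ← Finset.sum_div, ← Finset.mul_sum, hB]
            simp [pow_succ, mul_comm]
    · rw [curve_isAttractor.2.2] at hx
      obtain ⟨i, y, hy, rfl⟩ := Set.mem_iUnion.1 hx
      obtain ⟨a, ha, hya⟩ := hmem i y hy
      exact ⟨a, Finset.mem_biUnion.2 ⟨i, Finset.mem_univ i, ha⟩, hya⟩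

/-! ### Covering numbers and box dimension of the graph -/

theorem coverNumber_graph_le {δ : ℝ} (hδ : 0 < δ) {n : ℕ} (hn : 2 * (1 / 3) ^ n ≤ δ)
    {h : Plane → ℝ} {M : ℝ} (hM : OscBound n h M) :
    (coverNumber δ (graphOverCurve h) : ENNReal) ≤ ENNReal.ofReal (4 ^ n + 2 * M / δ) := by
  obtain ⟨S, hS, hcov⟩ := exists_cover hδ n 1 zero_le_one (by rwa [one_mul]) id
    (fun x y => by simp) h M hM
  have hsub : graphOverCurve h ⊆ ⋃ a ∈ S, Set.Icc a (fun i => a i + δ) := by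
    rintro _ ⟨x, hx, rfl⟩
    obtain ⟨a, ha, hxa⟩ := hcov x hx
    exact Set.mem_biUnion ha hxa
  have hle : coverNumber δ (graphOverCurve h) ≤ (S.card : ℕ∞) :=
    iInf_le (fun S : {S : Finset (Fin 3 → ℝ) //
      graphOverCurve h ⊆ ⋃ a ∈ S, Set.Icc a (fun i => a i + δ)} => (S.1.card : ℕ∞)) ⟨S, hsub⟩
  calc (coverNumber δ (graphOverCurve h) : ENNReal) ≤ ((S.card : ℕ∞) : ENNReal) := by
        exact_mod_cast hle
    _ = ENNReal.ofReal (S.card : ℝ) := by simp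
    _ ≤ _ := ENNReal.ofReal_le_ofReal hS

/-- Polynomial bounds for the covering numbers bound the upper box dimension. -/
theorem upperBoxDim_le {n : ℕ} {F : Set (Fin n → ℝ)} {C s : ℝ} (hC : 0 < C)
    (hF : ∀ δ : ℝ, 0 < δ → δ < 1 →
      (coverNumber δ F : ENNReal) ≤ ENNReal.ofReal (C * δ ^ (-s))) :
    upperBoxDim F ≤ (s : EReal) := by
  have hlog : Tendsto (fun δ : ℝ => -Real.log δ) (𝓝[>] 0) atTop :=
    tendsto_neg_atBot_atTop.comp Real.tendsto_log_nhdsGT_zero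
  -- The function is `log (C * δ ^ (-s)) / (-log δ)`, in which the constant `C` disappears in the
  -- limit.
  have hlim : Tendsto (fun δ : ℝ => ((Real.log C / -Real.log δ + s : ℝ) : EReal)) (𝓝[>] 0)
      (𝓝 (s : EReal)) := by
    refine (continuous_coe_real_ereal.tendsto s).comp ?_
    simpa using (hlog.const_div_atTop (Real.log C)).add_const s
  rw [← hlim.limsup_eq]
  refine limsup_le_limsup ?_
  have hmem : Set.Ioo (0 : ℝ) 1 ∈ 𝓝[>] (0 : ℝ) := Ioo_mem_nhdsGT one_pos
  filter_upwards [hmem] with δ hδ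
  have hl : 0 < -Real.log δ := neg_pos.2 (Real.log_neg hδ.1 hδ.2)
  have hpos : 0 < C * δ ^ (-s) := mul_pos hC (Real.rpow_pos_of_pos hδ.1 _)
  have h1 := ENNReal.log_monotone (hF δ hδ.1 hδ.2)
  rw [ENNReal.log_ofReal_of_pos hpos, Real.log_mul hC.ne' (Real.rpow_pos_of_pos hδ.1 _).ne',
    Real.log_rpow hδ.1] at h1
  refine (EReal.div_le_div_right_of_nonneg (EReal.coe_nonneg.2 hl.le) h1).trans_eq ?_
  rw [← EReal.coe_div]
  congr 1
  have hl' := hl.ne'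
  generalize Real.log δ = l at hl'
  have : l ≠ 0 := neg_ne_zero.1 hl'
  field_simp
  ring

theorem exists_coverNumber_graph_le {h : Plane → ℝ} {M : ℝ} {m : ℕ} (hM0 : 0 ≤ M)
    (hM : ∀ n, OscBound (n + m) h M) {δ : ℝ} (hδ : 0 < δ) (hδ1 : δ < 1) :
    (coverNumber δ (graphOverCurve h) : ENNReal) ≤
      ENNReal.ofReal ((36 * 6 ^ m + 2 * M) * δ ^ (-(Real.log 6 / Real.log 3))) := by
  have h3 : 0 < Real.log 3 := Real.log_pos (by norm_num)
  set s := Real.log 6 / Real.log 3 with hs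
  have hs1 : 1 ≤ s := (one_le_div h3).2 (Real.log_le_log (by norm_num) (by norm_num))
  have h36 : (3 : ℝ) ^ s = 6 := by
    rw [Real.rpow_def_of_pos (by norm_num), hs, mul_div_cancel₀ _ h3.ne',
      Real.exp_log (by norm_num)]
  obtain ⟨n, hn1, hn2⟩ := exists_nat_pow_near_of_lt_one hδ hδ1.le
    (show (0 : ℝ) < 1 / 3 by norm_num) (by norm_num)
  -- Here `(1/3) ^ (n + 1) < δ ≤ (1/3) ^ n`. One more level absorbs the factor `2`, and `m` more are
  -- needed because oscillation bounds are available only from level `m` on.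
  have hlevel : 2 * (1 / 3 : ℝ) ^ (n + 2 + m) ≤ δ := by
    have : (1 / 3 : ℝ) ^ m ≤ 1 := pow_le_one₀ (by norm_num) (by norm_num)
    have hp : (0 : ℝ) < (1 / 3) ^ (n + 1) := by positivity
    rw [pow_add, pow_succ]
    nlinarith
  refine (coverNumber_graph_le hδ hlevel (hM (n + 2))).trans (ENNReal.ofReal_le_ofReal ?_)
  have hinv : (3 : ℝ) ^ n ≤ δ⁻¹ := by
    rw [le_inv_comm₀ (by positivity) hδ, ← inv_pow, ← one_div]
    exact hn2
  have h6 : (6 : ℝ) ^ n ≤ δ ^ (-s) := by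
    calc (6 : ℝ) ^ n = ((3 : ℝ) ^ n) ^ s := by
          rw [← h36, ← Real.rpow_natCast, ← Real.rpow_natCast, ← Real.rpow_mul (by norm_num),
            ← Real.rpow_mul (by norm_num), mul_comm]
      _ ≤ (δ⁻¹) ^ s := Real.rpow_le_rpow (by positivity) hinv (by linarith)
      _ = δ ^ (-s) := by rw [Real.inv_rpow hδ.le, Real.rpow_neg hδ.le]
  -- The bound `4 ≤ 6` is where the exponent `log 4 / log 3` is given away; `36 * 6 ^ m` comes from
  -- the `2 + m` additional levels.
  have h4 : (4 : ℝ) ^ (n + 2 + m) ≤ 36 * 6 ^ m * δ ^ (-s) :=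
    calc (4 : ℝ) ^ (n + 2 + m) ≤ 6 ^ (n + 2 + m) :=
          pow_le_pow_left₀ (by norm_num) (by norm_num) _
      _ = 36 * 6 ^ m * 6 ^ n := by ring
      _ ≤ _ := mul_le_mul_of_nonneg_left h6 (by positivity)
  -- The oscillation term grows only like `δ⁻¹`, so `1 ≤ s` suffices to absorb it.
  have hd : δ⁻¹ ≤ δ ^ (-s) := by
    rw [← Real.rpow_neg_one]
    exact Real.rpow_le_rpow_of_exponent_ge hδ hδ1.le (by linarith)
  have hMd : 2 * M / δ ≤ 2 * M * δ ^ (-s) := by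
    rw [div_eq_mul_inv]
    exact mul_le_mul_of_nonneg_left hd (by positivity)
  linarith

end VonKoch

theorem mainTheorem8
    (H : Matrix (Fin 2) (Fin 2) ℝ) (r : Fin 4 → ℝ)
    (hHr : VonKoch.IsRegularHarmonicStructure H r)
    (h : VonKoch.Plane → ℝ)
    (hh : VonKoch.IsHarmonic H r h ∨ ∃ m : ℕ, 1 ≤ m ∧ VonKoch.IsPiecewiseHarmonic H r m h) :
    VonKoch.upperBoxDim (VonKoch.graphOverCurve h) ≤
      ((Real.log 6 / Real.log 3 : ℝ) : EReal) := by
  have hosc : ∀ f : VonKoch.Plane → ℝ, VonKoch.IsHarmonic H r f →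
      ∃ M, 0 ≤ M ∧ ∀ n, VonKoch.OscBound n f M := fun f hf =>
    ⟨_, abs_nonneg _, fun n =>
      VonKoch.oscBound_of_eq_pos hHr.sum_eq_one hHr.pos n f hf.1 _ _ (hf.eq_pos hHr)⟩
  have hbound : ∃ m M, 0 ≤ M ∧ ∀ n, VonKoch.OscBound (n + m) h M := by
    rcases hh with hh | ⟨m, -, hh⟩
    · exact ⟨0, hosc h hh⟩
    · exact ⟨m, VonKoch.exists_oscBound_of_wordMap m h fun w hw => hosc _ (hh.2 w hw)⟩
  obtain ⟨m, M, hM0, hM⟩ := hbound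
  exact VonKoch.upperBoxDim_le (by positivity) fun δ hδ hδ1 =>
    VonKoch.exists_coverNumber_graph_le hM0 hM hδ hδ1
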